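/- Let $n\ge 5$ and let $(m_{ij})_{1\le i,j\le n}$ be a symmetric matrix with $m_{ii}=1$ and $m_{ij}\in\{2,3,4,\dots\}\cup\{\infty\}$ for $i\ne j$, and let $$W=\langle s_1,\dots,s_n \mid (s_is_j)^{m_{ij}}=1 \text{ whenever } m_{ij}\neq\infty\rangle$$ be the associated Coxeter group of rank $n$. Assume that - $m_{12}$ and $m_{n-1,n}$ are finite, and the least divisor greater than $1$ of each of them is at least $5$; - for $2\le i\le n-2$, $m_{i,i+1}$ is finite with least divisor greater than $1$ equal to $3$ (i.e. $m_{i,i+1}$ is an odd multiple of $3$); - each of $m_{13}$ and $m_{n-2,n}$ is either $\infty$ or an odd multiple of $3$; - $m_{ij}=\infty$ for all other pairs $i<j$. A reflection of $W$ is a conjugate of some $s_i$. Then $W$ has no finite-index reflection subgroup; that is, there is no subgroup $V\subsetneq W$ of finite index which is generated by reflections of $W$. -/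

import Mathlib

/-- The underlying graph of the divisibility diagram of a Coxeter system with Coxeter matrix `M`:
the vertices are the generators, and two distinct generators are joined iff `m i j` is finite.
(In `CoxeterMatrix`, the exponent `∞` is represented by `0`.) -/
def CoxeterMatrix.divGraph {B : Type*} (M : CoxeterMatrix B) : SimpleGraph B where
  Adj i j := i ≠ j ∧ M i j ≠ 0
  symm := ⟨fun i j h => ⟨h.1.symm, by rw [M.symmetric j i]; exact h.2⟩⟩
  loopless := ⟨fun _ h => h.1 rfl⟩

/-- The label of an edge `{i, j}` of the divisibility diagram: the least divisor greater than `1`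
of `m i j`. It is only used for pairs `i, j` adjacent in `M.divGraph`, for which `2 ≤ m i j < ∞`. -/
def CoxeterMatrix.divLabel {B : Type*} (M : CoxeterMatrix B) (i j : B) : ℕ :=
  (M i j).minFac

/-- The divisibility diagram of `M` is a path with `n` vertices (numbered `0, …, n - 1` from left
to right), possibly with one extra edge closing up each of its two ends to a triangle.
The first and the last edge of the path carry labels at least `5`, all other edges of the path
carry label `3`, and each of the two additional pairs `{0, 2}`, `{n - 3, n - 1}` is either not
joined or joined by an edge with label `3`. There are no further edges. -/
structure CoxeterMatrix.IsPathSeries {n : ℕ} (M : CoxeterMatrix (Fin n)) : Prop where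
  first_edge : ∀ i j : Fin n, (i : ℕ) = 0 → (j : ℕ) = 1 →
    M.divGraph.Adj i j ∧ 5 ≤ M.divLabel i j
  last_edge : ∀ i j : Fin n, (i : ℕ) + 2 = n → (j : ℕ) + 1 = n →
    M.divGraph.Adj i j ∧ 5 ≤ M.divLabel i j
  inner_edge : ∀ i j : Fin n, 1 ≤ (i : ℕ) → (j : ℕ) = (i : ℕ) + 1 → (j : ℕ) + 2 ≤ n →
    M.divGraph.Adj i j ∧ M.divLabel i j = 3
  left_chord : ∀ i j : Fin n, (i : ℕ) = 0 → (j : ℕ) = 2 →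
    M.divGraph.Adj i j → M.divLabel i j = 3
  right_chord : ∀ i j : Fin n, (i : ℕ) + 3 = n → (j : ℕ) + 1 = n →
    M.divGraph.Adj i j → M.divLabel i j = 3
  no_other_edge : ∀ i j : Fin n, (i : ℕ) + 1 < (j : ℕ) →
    ¬ ((i : ℕ) = 0 ∧ (j : ℕ) = 2) → ¬ ((i : ℕ) + 3 = n ∧ (j : ℕ) + 1 = n) →
    ¬ M.divGraph.Adj i j

/-- A reflection subgroup of a Coxeter group: a proper subgroup generated by reflections, that is,
by conjugates of the simple generators. -/
def CoxeterSystem.IsReflectionSubgroup {B : Type*} {M : CoxeterMatrix B} {W : Type*} [Group W]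
    (cs : CoxeterSystem M W) (V : Subgroup W) : Prop :=
  V ≠ ⊤ ∧ ∃ T : Set W, (∀ t ∈ T, cs.IsReflection t) ∧ Subgroup.closure T = V

/-!
Suppose that `V` is generated by reflections and let `W` act on `X = W ⧸ V`. The reflections in `V`
fix a point above the base point in each `W`-set over `X` in which simple reflections fix all points
above their fixed points, so such a `W`-set has an equivariant section. For the `W`-sets `X × G`
obtained by shearing the action of some of the generators along a function `f : X → G`, this
says that `f` is a sum `g + k`, with `g` invariant under those generators and `k` under the others.

For a path series, `W` is an amalgamated product of two parabolic subgroups `P` and `P'` over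
`⟨s⟩`, for the third generator `s`, so each `s`-invariant function is a sum of a `P`-invariant and a
`P'`-invariant one. View the pairs of points swapped by `s` as the edges of a bipartite graph whose
vertices are the orbits of `P` and of `P'`. If `X` is finite, then comparing dimensions shows that
this graph has a leaf: `s`, and with it each of its conjugates by elements of `P`, say, acts as a
transposition on some `P`-orbit. At the end of the path, two transpositions whose product has order
prime to `6` are equal, and splitting the indicator function of one of the two swapped points gives
a contradiction.
-/

/-- `V` is generated by reflections of `cs`; unlike for `CoxeterSystem.IsReflectionSubgroup`,
`V = ⊤` is allowed. -/
def IsGeneratedByReflections {B W : Type*} [Group W] {M : CoxeterMatrix B} (cs : CoxeterSystem M W)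
    (V : Subgroup W) : Prop :=
  ∃ T : Set W, (∀ t ∈ T, cs.IsReflection t) ∧ Subgroup.closure T = V

/-- The action of `H` on `X × G` lifting that on `X`, obtained from the one that is trivial on `G`
by conjugation with the shear `(x, a) ↦ (x, a + f x)`. -/
def shearHom {H X G : Type*} [Group H] [MulAction H X] [AddCommGroup G] (f : X → G) :
    H →* Equiv.Perm (X × G) where
  toFun w := Equiv.prodShear (MulAction.toPerm w) fun x => Equiv.addRight (f (w • x) - f x)
  map_one' := by ext <;> simp
  map_mul' w w' := by (ext <;> simp [mul_smul]); abel

section Shear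

variable {H X G : Type*} [Group H] [MulAction H X] [AddCommGroup G]

theorem shearHom_apply (f : X → G) (w : H) (y : X × G) :
    shearHom f w y = (w • y.1, y.2 + (f (w • y.1) - f y.1)) :=
  rfl

theorem shearHom_congr {f f' : X → G} {w : H}
    (h : ∀ x, f (w • x) - f x = f' (w • x) - f' x) : shearHom f w = shearHom f' w := by
  ext1 y
  rw [shearHom_apply, shearHom_apply, h]

theorem shearHom_mul_shearHom_pow_of_congr {f f₁ f₂ : X → G} {a b : H} {m : ℕ}
    (hm : (a * b) ^ m = 1) (ha : ∀ x, f₁ (a • x) - f₁ x = f (a • x) - f x)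
    (hb : ∀ x, f₂ (b • x) - f₂ x = f (b • x) - f x) :
    (shearHom f₁ a * shearHom f₂ b) ^ m = 1 := by
  rw [shearHom_congr ha, shearHom_congr hb, ← map_mul, ← map_pow, hm, map_one]

theorem shearHom_mul_shearHom_zero_pow_apply {f : X → G} {a b : H} (ha : a * a = 1)
    (hb : b * b = 1) (hab : ∀ x, f (a • x) = f (b • x)) (l : ℕ) (y : X × G) :
    ((shearHom f a * shearHom 0 b : Equiv.Perm (X × G)) ^ l) y =
      ((a * b) ^ l • y.1, y.2 + l • (f y.1 - f (b • y.1))) := by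
  have haa (x : X) : a • a • x = x := by rw [smul_smul, ha, one_smul]
  have hbb (x : X) : b • b • x = x := by rw [smul_smul, hb, one_smul]
  induction l generalizing y with
  | zero => simp
  | succ l ih =>
    have hstep : (shearHom f a * shearHom 0 b : Equiv.Perm (X × G)) y =
        ((a * b) • y.1, y.2 + (f y.1 - f (b • y.1))) := by
      simp only [Equiv.Perm.mul_apply, shearHom_apply, Pi.zero_apply, mul_smul, hab, hbb, sub_zero,
        add_zero]
    have hinv : f ((a * b) • y.1) - f (b • (a * b) • y.1) = f y.1 - f (b • y.1) := by
      rw [mul_smul, ← hab (a • b • y.1), haa, hab, hbb]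
    rw [pow_succ, Equiv.Perm.mul_apply, hstep, ih, hinv, pow_succ, mul_smul, succ_nsmul']
    simp only [mul_smul, add_assoc]

theorem shearHom_mul_shearHom_zero_pow {f : X → G} {a b : H} {m : ℕ} (ha : a * a = 1)
    (hb : b * b = 1) (hab : ∀ x, f (a • x) = f (b • x)) (hm : (a * b) ^ m = 1)
    (hG : ∀ c : G, m • c = 0) :
    (shearHom f a * shearHom 0 b : Equiv.Perm (X × G)) ^ m = 1 := by
  ext1 y
  rw [shearHom_mul_shearHom_zero_pow_apply ha hb hab, hm, hG, one_smul, add_zero]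
  rfl

end Shear

section Splitting

variable {B W : Type*} [Group W] {M : CoxeterMatrix B} {cs : CoxeterSystem M W} {V : Subgroup W}

namespace IsGeneratedByReflections

-- A simple reflection fixing `π y` fixes `y`; applied to `y = w⁻¹ • y₀`, this shows that all
-- reflections in `V` fix the point `y₀` chosen above the base point.
theorem exists_section (hV : IsGeneratedByReflections cs V) {Y : Type*} [MulAction W Y]
    (π : Y →[W] W ⧸ V) (hπ : Function.Surjective π)
    (hfix : ∀ i y, cs.simple i • π y = π y → cs.simple i • y = y) :
    ∃ σ : W ⧸ V →[W] Y, ∀ x, π (σ x) = x := by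
  obtain ⟨T, hT, rfl⟩ := hV
  obtain ⟨y₀, hy₀⟩ := hπ ((1 : W) : W ⧸ Subgroup.closure T)
  have hstab : Subgroup.closure T ≤ MulAction.stabilizer W y₀ := by
    refine (Subgroup.closure_le _).2 fun t ht => ?_
    obtain ⟨w, i, rfl⟩ := hT t ht
    have hbase : (w * cs.simple i * w⁻¹) • π y₀ = π y₀ := by
      rw [← MulAction.mem_stabilizer_iff, hy₀, MulAction.stabilizer_quotient]
      exact Subgroup.subset_closure ht
    have hlift : cs.simple i • w⁻¹ • y₀ = w⁻¹ • y₀ := hfix i _ <| by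
      rw [map_smul, eq_inv_smul_iff, ← mul_smul, ← mul_smul, hbase]
    rw [SetLike.mem_coe, MulAction.mem_stabilizer_iff, mul_smul, mul_smul, hlift, smul_inv_smul]
  have hwd (a b : W) (hab : (QuotientGroup.leftRel (Subgroup.closure T)) a b) :
      a • y₀ = b • y₀ := by
    have hab' : (a⁻¹ * b) • y₀ = y₀ := hstab (QuotientGroup.leftRel_apply.1 hab)
    rwa [mul_smul, inv_smul_eq_iff, eq_comm] at hab'
  refine ⟨⟨Quotient.lift (· • y₀) hwd, ?_⟩, ?_⟩
  · rintro w ⟨a⟩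
    exact mul_smul w a y₀
  · rintro ⟨a⟩
    change π (a • y₀) = _
    rw [map_smul, hy₀]
    exact congrArg _ (mul_one a)

-- The liftable permutations define an action of `W` on `(W ⧸ V) × G`; the second component of an
-- equivariant section of the first projection is the required function.
theorem exists_apply_simple_smul_eq {G : Type*} [AddCommGroup G]
    (hV : IsGeneratedByReflections cs V) {F : B → W ⧸ V → G}
    (hF : M.IsLiftable fun i => shearHom (F i) (cs.simple i)) :
    ∃ k : W ⧸ V → G, ∀ i x, k (cs.simple i • x) = k x + (F i (cs.simple i • x) - F i x) := by
  let φ : W →* Equiv.Perm ((W ⧸ V) × G) := cs.lift ⟨_, hF⟩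
  have hφ (i : B) (y : (W ⧸ V) × G) : φ (cs.simple i) y = shearHom (F i) (cs.simple i) y := by
    rw [cs.lift_apply_simple hF]
  have hfst (w : W) (y : (W ⧸ V) × G) : (φ w y).1 = w • y.1 := by
    induction w using cs.simple_induction_left with
    | one => simp
    | mul_simple_left w i ih =>
      rw [map_mul, Equiv.Perm.mul_apply, hφ, shearHom_apply, ih, mul_smul]
  let _ : MulAction W ((W ⧸ V) × G) := MulAction.compHom _ φ
  have hsmul (i : B) (y : (W ⧸ V) × G) : cs.simple i • y =
      (cs.simple i • y.1, y.2 + (F i (cs.simple i • y.1) - F i y.1)) :=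
    hφ i y
  obtain ⟨σ, hσ⟩ := hV.exists_section (Y := (W ⧸ V) × G) ⟨Prod.fst, hfst⟩ Prod.fst_surjective
    fun i y (hy : cs.simple i • y.1 = y.1) => by rw [hsmul, hy, sub_self, add_zero]
  refine ⟨fun x => (σ x).2, fun i x => ?_⟩
  have hx : (σ x).1 = x := hσ x
  change (σ (cs.simple i • x)).2 = (σ x).2 + _
  rw [map_smul, hsmul, hx]

theorem exists_eq_add {G : Type*} [AddCommGroup G] (hV : IsGeneratedByReflections cs V)
    (S : Set B) (f : W ⧸ V → G)
    (hf : ∀ i ∈ S, ∀ j ∉ S,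
      (shearHom f (cs.simple i) * shearHom 0 (cs.simple j)) ^ M i j = 1) :
    ∃ g k : W ⧸ V → G, (∀ x, f x = g x + k x) ∧
      (∀ i ∈ S, ∀ x, g (cs.simple i • x) = g x) ∧ ∀ j ∉ S, ∀ x, k (cs.simple j • x) = k x := by
  classical
  let F (i : B) : W ⧸ V → G := if i ∈ S then f else 0
  have hF : M.IsLiftable fun i => shearHom (F i) (cs.simple i) := by
    intro i j
    have hsymm : (shearHom (F i) (cs.simple i) * shearHom (F j) (cs.simple j)) ^ M i j =
        ((shearHom (F j) (cs.simple j) * shearHom (F i) (cs.simple i)) ^ M j i)⁻¹ := by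
      simp only [← inv_pow, mul_inv_rev, ← map_inv, cs.inv_simple, M.symmetric i j]
    have hsame (h : F i = F j) :
        (shearHom (F i) (cs.simple i) * shearHom (F j) (cs.simple j)) ^ M i j = 1 := by
      simp only [h, ← map_mul, ← map_pow, cs.simple_mul_simple_pow, map_one]
    by_cases hi : i ∈ S <;> by_cases hj : j ∈ S
    · exact hsame (by simp only [F, hi, hj])
    · simpa only [F, if_pos hi, if_neg hj] using hf i hi j hj
    · rw [hsymm, inv_eq_one]
      simpa only [F, if_neg hi, if_pos hj] using hf j hj i hi
    · exact hsame (by simp only [F, hi, hj])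
  obtain ⟨k, hk⟩ := hV.exists_apply_simple_smul_eq hF
  refine ⟨fun x => f x - k x, k, fun x => (sub_add_cancel _ _).symm, fun i hi x => ?_,
    fun j hj x => ?_⟩
  · simp only [hk, F, if_pos hi]
    abel
  · simp only [hk, F, if_neg hj, Pi.zero_apply, sub_self, add_zero]

-- If `s_q` did swap `u` and `v`, then `f u = f v` for each sum `f` of an `S`-invariant and an
-- `Sᶜ`-invariant function; the indicator function of `v` modulo `m` is such a sum.
theorem simple_smul_ne_of_swap (hV : IsGeneratedByReflections cs V) {u v : W ⧸ V} (huv : u ≠ v)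
    {S : Set B} (hS : ∀ i ∈ S, cs.simple i • u = v) {m : ℕ} (hm : 1 < m)
    (h : ∀ i ∈ S, ∀ j ∉ S, M i j = 0 ∨ cs.simple j • u = u ∨ cs.simple j • v = v ∨
      (cs.simple j • u = v ∧ m ∣ M i j)) {p q : B} (hp : p ∈ S) (hq : q ∉ S) :
    cs.simple q • u ≠ v := by
  classical
  intro hqu
  have : Fact (1 < m) := ⟨hm⟩
  have hsingle (i : B) (y : W ⧸ V) (a : ZMod m) (x : W ⧸ V) :
      (Pi.single y a : W ⧸ V → ZMod m) (cs.simple i • x) =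
        (Pi.single (cs.simple i • y) a : W ⧸ V → ZMod m) x := by
    simp only [Pi.single_apply, ← eq_inv_smul_iff (g := cs.simple i), cs.inv_simple]
  have hswap {i : B} (hi : cs.simple i • u = v) : cs.simple i • v = u := by
    rw [← hi, smul_smul, cs.simple_mul_simple_self, one_smul]
  obtain ⟨g, k, hgk, hg, hk⟩ := hV.exists_eq_add S (Pi.single v (1 : ZMod m)) <| by
    intro i hi j hj
    have hM := cs.simple_mul_simple_pow i j
    rcases h i hi j hj with h0 | hju | hjv | ⟨hju, hdvd⟩
    · rw [h0, pow_zero]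
    · exact shearHom_mul_shearHom_pow_of_congr (f := Pi.single u (-1)) hM
        (by simp [hsingle, hS i hi, hswap (hS i hi), Pi.single_neg, add_comm, sub_eq_add_neg])
        (by simp [hsingle, hju])
    · exact shearHom_mul_shearHom_pow_of_congr (f := Pi.single v 1) hM (fun _ => rfl)
        (by simp [hsingle, hjv])
    · exact shearHom_mul_shearHom_zero_pow (cs.simple_mul_simple_self i)
        (cs.simple_mul_simple_self j) (by simp [hsingle, hswap (hS i hi), hswap hju]) hM
        fun c => by rw [nsmul_eq_mul, (ZMod.natCast_eq_zero_iff _ _).2 hdvd, zero_mul]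
  have hval : (Pi.single v 1 : W ⧸ V → ZMod m) u = (Pi.single v 1 : W ⧸ V → ZMod m) v := by
    rw [hgk u, hgk v, ← hg p hp u, ← hk q hq u, hS p hp, hqu]
  simp [huv] at hval

end IsGeneratedByReflections

end Splitting

section InvariantFunctions

variable {W X Z : Type*} [Group W] [MulAction W X]

theorem apply_smul_of_mem_closure {T : Set W} {f : X → Z} (hf : ∀ t ∈ T, ∀ x, f (t • x) = f x)
    {w : W} (hw : w ∈ Subgroup.closure T) (x : X) : f (w • x) = f x := by
  induction hw using Subgroup.closure_induction generalizing x with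
  | mem t ht => exact hf t ht x
  | one => rw [one_smul]
  | mul a b _ _ iha ihb => rw [mul_smul, iha, ihb]
  | inv a _ iha => rw [← iha (a⁻¹ • x), smul_inv_smul]

theorem mem_orbit_zpowers_iff_of_mul_self_eq_one {g : W} (hg : g * g = 1) {x y : X} :
    y ∈ MulAction.orbit (Subgroup.zpowers g) x ↔ y = x ∨ y = g • x := by
  constructor
  · rintro ⟨⟨_, m, rfl⟩, rfl⟩
    have heven (l : ℤ) : g ^ (2 * l) = 1 := by rw [zpow_mul, zpow_two, hg, one_zpow]
    obtain ⟨l, rfl | rfl⟩ := Int.even_or_odd' m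
    · exact .inl (by simp [Subgroup.smul_def, heven])
    · exact .inr (by simp [Subgroup.smul_def, zpow_add, heven])
  · rintro (rfl | rfl)
    · exact MulAction.mem_orbit_self _
    · exact MulAction.mem_orbit _ (⟨g, Subgroup.mem_zpowers g⟩ : Subgroup.zpowers g)

end InvariantFunctions

section Transposition

variable {W X : Type*} [Group W] [MulAction W X]

open Classical in
/-- The action of `g` restricts on `O` to the transposition of two points of `O`. -/
def ActsAsTransposition (g : W) (O : Set X) : Prop :=
  ∃ u ∈ O, ∃ v ∈ O, u ≠ v ∧ ∀ x ∈ O, g • x = Equiv.swap u v x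

theorem actsAsTransposition_orbit {g : W} (hg : g * g = 1) {P : Subgroup W} (hgP : g ∈ P) {u : X}
    (hu : g • u ≠ u) (h : ∀ x ∈ MulAction.orbit P u, g • x ≠ x → x = u ∨ x = g • u) :
    ActsAsTransposition g (MulAction.orbit P u) := by
  classical
  refine ⟨u, MulAction.mem_orbit_self u, g • u, MulAction.mem_orbit u (⟨g, hgP⟩ : P), hu.symm,
    fun x hx => ?_⟩
  by_cases hgx : g • x = x
  · have hne : x ≠ u ∧ x ≠ g • u := by
      refine ⟨fun h => hu (h ▸ hgx), ?_⟩
      rintro rfl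
      exact hu (smul_left_cancel g hgx)
    rw [Equiv.swap_apply_of_ne_of_ne hne.1 hne.2, hgx]
  · rcases h x hx hgx with rfl | rfl
    · rw [Equiv.swap_apply_left]
    · rw [Equiv.swap_apply_right, smul_smul, hg, one_smul]

end Transposition

section BipartiteGraph

variable {K E A A' : Type*} [Field K] [Fintype E] [Nonempty E]

-- The functions `e ↦ g (α e) + k (β e)` form a space of dimension less than `card A + card A'`,
-- since adding a constant to `g` and subtracting it from `k` changes nothing.
theorem card_lt_card_add_card_of_forall_eq_add [Fintype A] [Fintype A'] (α : E → A) (β : E → A')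
    (h : ∀ f : E → K, ∃ (g : A → K) (k : A' → K), ∀ e, f e = g (α e) + k (β e)) :
    Fintype.card E < Fintype.card A + Fintype.card A' := by
  let L : (A → K) × (A' → K) →ₗ[K] E → K :=
    (LinearMap.funLeft K K α).coprod (LinearMap.funLeft K K β)
  have hsurj : Function.Surjective L := fun f => by
    obtain ⟨g, k, hgk⟩ := h f
    exact ⟨(g, k), funext fun e => (hgk e).symm⟩
  have hker : 0 < Module.finrank K (LinearMap.ker L) := by
    have hA : Nonempty A := ‹Nonempty E›.map α
    refine Module.finrank_pos_iff_exists_ne_zero.2 ⟨⟨((fun _ => 1), (fun _ => -1)), ?_⟩, ?_⟩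
    · ext e
      simp [L, LinearMap.funLeft]
    · simp [Subtype.ext_iff, Prod.ext_iff, funext_iff]
  have hrank := L.finrank_range_add_finrank_ker
  rw [LinearMap.range_eq_top.2 hsurj, finrank_top, Module.finrank_prod,
    Module.finrank_fintype_fun_eq_card, Module.finrank_fintype_fun_eq_card,
    Module.finrank_fintype_fun_eq_card] at hrank
  lia

end BipartiteGraph

theorem two_mul_card_range_le {E A : Type*} [Fintype E] (α : E → A) [Fintype (Set.range α)]
    (h : ∀ e, ∃ e', α e' = α e ∧ e' ≠ e) : 2 * Fintype.card (Set.range α) ≤ Fintype.card E := by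
  classical
  refine Finset.mul_card_image_le_card_of_maps_to (f := Set.rangeFactorization α)
    (fun _ _ => Finset.mem_univ _) 2 ?_
  rintro ⟨_, e, rfl⟩ -
  obtain ⟨e', hα, hne⟩ := h e
  exact Finset.one_lt_card.2 ⟨e', by simp [Subtype.ext_iff, hα], e, by simp [Subtype.ext_iff], hne⟩

-- `E` is the edge set of a bipartite graph, and the conclusion is the existence of a leaf.
theorem exists_fiber_subsingleton_of_forall_eq_add {K E A A' : Type*} [Field K] [Finite E]
    [Nonempty E] (α : E → A) (β : E → A')
    (h : ∀ f : E → K, ∃ (g : A → K) (k : A' → K), ∀ e, f e = g (α e) + k (β e)) :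
    ∃ e, (∀ e', α e' = α e → e' = e) ∨ ∀ e', β e' = β e → e' = e := by
  by_contra! hcon
  have := Fintype.ofFinite E
  have := Fintype.ofFinite (Set.range α)
  have := Fintype.ofFinite (Set.range β)
  have hα := two_mul_card_range_le α fun e => (hcon e).1
  have hβ := two_mul_card_range_le β fun e => (hcon e).2
  have hlt := card_lt_card_add_card_of_forall_eq_add (K := K) (Set.rangeFactorization α)
    (Set.rangeFactorization β) fun f => by
      obtain ⟨g, k, hgk⟩ := h f
      exact ⟨fun a => g a, fun b => k b, hgk⟩
  lia

section Decomposition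

variable {W X K : Type*} [Group W] [MulAction W X] [Finite X] [Field K] {g : W}
  {P P' : Subgroup W}

-- The pairs `{x, g • x}` moved by `g` are the edges of a bipartite graph whose vertices are the
-- `P`-orbits and the `P'`-orbits. By assumption, edge functions are sums of vertex functions.
theorem exists_forall_mem_orbit_eq_or_eq_smul (hg : g * g = 1) (hmove : ∃ x : X, g • x ≠ x)
    (hP : g ∈ P) (hP' : g ∈ P')
    (hadd : ∀ f : X → K, (∀ x, f (g • x) = f x) → ∃ f₁ f₂ : X → K, (∀ x, f x = f₁ x + f₂ x) ∧
      (∀ w ∈ P, ∀ x, f₁ (w • x) = f₁ x) ∧ ∀ w ∈ P', ∀ x, f₂ (w • x) = f₂ x) :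
    ∃ u : X, g • u ≠ u ∧ ((∀ x ∈ MulAction.orbit P u, g • x ≠ x → x = u ∨ x = g • u) ∨
      ∀ x ∈ MulAction.orbit P' u, g • x ≠ x → x = u ∨ x = g • u) := by
  let π : X → MulAction.orbitRel.Quotient (Subgroup.zpowers g) X := Quotient.mk _
  have hπ {x y : X} : π x = π y ↔ x = y ∨ x = g • y :=
    Quotient.eq.trans (mem_orbit_zpowers_iff_of_mul_self_eq_one hg)
  let E : Set (MulAction.orbitRel.Quotient (Subgroup.zpowers g) X) := π '' {x | g • x ≠ x}
  have : Nonempty E := (Set.Nonempty.image π hmove).to_subtype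
  have hle {Q : Subgroup W} (hQ : g ∈ Q) :
      MulAction.orbitRel (Subgroup.zpowers g) X ≤ MulAction.orbitRel Q X := by
    rintro x y ⟨⟨w, hw⟩, rfl⟩
    exact ⟨⟨w, Subgroup.zpowers_le.2 hQ hw⟩, rfl⟩
  let vertex {Q : Subgroup W} (hQ : g ∈ Q) : E → MulAction.orbitRel.Quotient Q X :=
    fun e => Quotient.map id (hle hQ) e.1
  obtain ⟨⟨_, u, hu, rfl⟩, he⟩ :=
    exists_fiber_subsingleton_of_forall_eq_add (vertex hP) (vertex hP') fun f => by
      obtain ⟨f₁, f₂, hf, hf₁, hf₂⟩ := hadd (Function.extend Subtype.val f 0 ∘ π) fun x =>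
        congrArg (Function.extend Subtype.val f 0) (hπ.2 (.inr rfl))
      refine ⟨Quotient.lift f₁ ?_, Quotient.lift f₂ ?_, ?_⟩
      · rintro _ x ⟨w, rfl⟩
        exact hf₁ w w.2 x
      · rintro _ x ⟨w, rfl⟩
        exact hf₂ w w.2 x
      · rintro ⟨_, x, hx, rfl⟩
        exact (Subtype.val_injective.extend_apply f 0 _).symm.trans (hf x)
  refine ⟨u, hu, he.imp ?_ ?_⟩ <;> exact fun he x hx hgx => hπ.1 <|
    congrArg Subtype.val <| he ⟨π x, x, hgx, rfl⟩ (Quotient.sound hx)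

open scoped Pointwise in
theorem exists_actsAsTransposition (hg : g * g = 1) (hmove : ∃ x : X, g • x ≠ x)
    (hP : g ∈ P) (hP' : g ∈ P')
    (hadd : ∀ f : X → K, (∀ x, f (g • x) = f x) → ∃ f₁ f₂ : X → K, (∀ x, f x = f₁ x + f₂ x) ∧
      (∀ w ∈ P, ∀ x, f₁ (w • x) = f₁ x) ∧ ∀ w ∈ P', ∀ x, f₂ (w • x) = f₂ x) :
    ∃ O : Set X, ActsAsTransposition g O ∧
      (P ≤ MulAction.stabilizer W O ∨ P' ≤ MulAction.stabilizer W O) := by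
  obtain ⟨u, hu, h | h⟩ := exists_forall_mem_orbit_eq_or_eq_smul hg hmove hP hP' hadd
  · exact ⟨_, actsAsTransposition_orbit hg hP hu h,
      .inl fun w hw => MulAction.smul_orbit (⟨w, hw⟩ : P) u⟩
  · exact ⟨_, actsAsTransposition_orbit hg hP' hu h,
      .inr fun w hw => MulAction.smul_orbit (⟨w, hw⟩ : P') u⟩

end Decomposition

section Swap

open Equiv

variable {X : Type*} [DecidableEq X]

theorem swap_mul_swap_pow_three {a b c : X} (hab : a ≠ b)
    (hac : a ≠ c) (hbc : b ≠ c) : (swap a b * swap a c) ^ 3 = 1 := by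
  have braid : swap a b * swap a c * swap a b = swap a c * swap a b * swap a c := by
    nth_rw 2 [← swap_inv a b]
    nth_rw 3 [← swap_inv a c]
    rw [← swap_apply_apply, ← swap_apply_apply, swap_apply_left, swap_apply_left,
      swap_apply_of_ne_of_ne hac.symm hbc.symm, swap_apply_of_ne_of_ne hab.symm hbc, swap_comm]
  calc (swap a b * swap a c) ^ 3
      = swap a b * swap a c * swap a b * (swap a c * swap a b * swap a c) := by
        simp only [pow_three', mul_assoc]
    _ = 1 := by rw [← braid]; simp [mul_assoc]

theorem swap_mul_swap_pow_six {u v x y : X} (huv : u ≠ v)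
    (hxy : x ≠ y) : (swap u v * swap x y) ^ 6 = 1 := by
  have shared (a b c : X) (hab : a ≠ b) (hac : a ≠ c) : (swap a b * swap a c) ^ 6 = 1 := by
    obtain rfl | hbc := eq_or_ne b c
    · rw [swap_mul_self, one_pow]
    · rw [show 6 = 3 * 2 from rfl, pow_mul, swap_mul_swap_pow_three hab hac hbc, one_pow]
  by_cases hdisj : x ≠ u ∧ x ≠ v ∧ y ≠ u ∧ y ≠ v
  · have hcomm : Commute (swap u v) (swap x y) := by
      rw [commute_iff_eq, ← mul_inv_eq_iff_eq_mul, ← swap_apply_apply,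
        swap_apply_of_ne_of_ne hdisj.1 hdisj.2.1, swap_apply_of_ne_of_ne hdisj.2.2.1 hdisj.2.2.2]
    rw [hcomm.mul_pow, show 6 = 2 * 3 from rfl, pow_mul, pow_mul]
    simp [sq]
  · obtain rfl | rfl | rfl | rfl : x = u ∨ x = v ∨ y = u ∨ y = v := by grind
    · exact shared _ _ _ huv hxy
    · rw [swap_comm u]; exact shared _ _ _ huv.symm hxy
    · rw [swap_comm x]; exact shared _ _ _ huv hxy.symm
    · rw [swap_comm u, swap_comm x]; exact shared _ _ _ huv.symm hxy.symm

end Swap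

section Transposition

open scoped Pointwise

variable {W X : Type*} [Group W] [MulAction W X] {a b g : W} {O : Set X}

namespace ActsAsTransposition

theorem exists_smul_eq (h : ActsAsTransposition g O) :
    ∃ u ∈ O, ∃ v ∈ O, u ≠ v ∧ g • u = v := by
  classical
  obtain ⟨u, hu, v, hv, huv, hg⟩ := h
  exact ⟨u, hu, v, hv, huv, by rw [hg u hu, Equiv.swap_apply_left]⟩

theorem smul_mem (h : ActsAsTransposition g O) {x : X} (hx : x ∈ O) : g • x ∈ O := by
  classical
  obtain ⟨u, hu, v, hv, -, hg⟩ := h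
  rw [hg x hx, Equiv.swap_apply_def]
  split_ifs
  exacts [hv, hu, hx]

theorem smul_eq_or_smul_eq_or_smul_eq (h : ActsAsTransposition g O) {u v : X} (hu : u ∈ O)
    (hv : v ∈ O) (huv : u ≠ v) : g • u = v ∨ g • u = u ∨ g • v = v := by
  classical
  obtain ⟨u', -, v', -, -, hg⟩ := h
  rw [hg u hu, hg v hv, Equiv.swap_apply_def, Equiv.swap_apply_def]
  grind

theorem conj (h : ActsAsTransposition g O) {w : W} (hw : w ∈ MulAction.stabilizer W O) :
    ActsAsTransposition (w * g * w⁻¹) O := by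
  classical
  obtain ⟨u, hu, v, hv, huv, hg⟩ := h
  have hmem := MulAction.mem_stabilizer_set.1 hw
  have hmem' := MulAction.mem_stabilizer_set.1 (inv_mem hw)
  refine ⟨w • u, (hmem u).2 hu, w • v, (hmem v).2 hv, (smul_left_cancel w).mt huv,
    fun x hx => ?_⟩
  rw [mul_smul, mul_smul, hg _ ((hmem' x).2 hx)]
  exact (congrArg (· x) (Equiv.swap_apply_apply (MulAction.toPerm w) u v)).symm

theorem mul_pow_six_smul (ha : ActsAsTransposition a O) (hb : ActsAsTransposition b O) {x : X}
    (hx : x ∈ O) : (a * b) ^ 6 • x = x := by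
  classical
  have hbO (y : X) (hy : y ∈ O) : b • y ∈ O := hb.smul_mem hy
  have haO (y : X) (hy : y ∈ O) : a • y ∈ O := ha.smul_mem hy
  obtain ⟨u, -, v, -, huv, hau⟩ := ha
  obtain ⟨u', -, v', -, huv', hbu⟩ := hb
  have hpow (l : ℕ) (y : X) (hy : y ∈ O) :
      (a * b) ^ l • y = ((Equiv.swap u v * Equiv.swap u' v') ^ l) y := by
    induction l generalizing y with
    | zero => simp
    | succ l ih =>
      rw [pow_succ, mul_smul, pow_succ, Equiv.Perm.mul_apply, Equiv.Perm.mul_apply, ← hbu y hy,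
        ← hau _ (hbO y hy), mul_smul, ih _ (haO _ (hbO y hy))]
  rw [hpow 6 x hx, swap_mul_swap_pow_six huv huv', Equiv.Perm.one_apply]

theorem smul_eq_smul_of_coprime (ha : ActsAsTransposition a O) (hb : ActsAsTransposition b O)
    (haa : a * a = 1) {m : ℕ} (hab : (a * b) ^ m = 1) (hm : Nat.Coprime 6 m) {x : X}
    (hx : x ∈ O) : a • x = b • x := by
  have hperiod : MulAction.period (a * b) x ∣ 1 := hm ▸ Nat.dvd_gcd
    (MulAction.pow_smul_eq_iff_period_dvd.1 (ha.mul_pow_six_smul hb hx))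
    (MulAction.pow_smul_eq_iff_period_dvd.1 (by rw [hab, one_smul]))
  have hfix : a • b • x = x := by
    simpa only [pow_one, mul_smul] using MulAction.pow_smul_eq_iff_period_dvd.2 hperiod
  nth_rw 1 [← hfix]
  rw [smul_smul, haa, one_smul]

end ActsAsTransposition

end Transposition

section PathEnd

variable {B W : Type*} [Group W] {M : CoxeterMatrix B} {cs : CoxeterSystem M W} {V : Subgroup W}

/-- `p`, `q`, `r` are the three generators at one end of a divisibility diagram of path series type,
listed from the end inwards. A multiple `M p r` or `M q r` of `3` may be `0`, which encodes `∞`. -/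
structure IsPathEnd (M : CoxeterMatrix B) (p q r : B) : Prop where
  five_le_minFac : 5 ≤ (M p q).minFac
  three_dvd_left : 3 ∣ M p r
  three_dvd_right : 3 ∣ M q r
  eq_zero_left : ∀ j, j ≠ p → j ≠ q → j ≠ r → M p j = 0
  eq_zero_right : ∀ j, j ≠ p → j ≠ q → j ≠ r → M q j = 0

namespace IsPathEnd

variable {p q r : B}

theorem coprime_six (h : IsPathEnd M p q r) : Nat.Coprime 6 (M p q) := by
  have hdvd (d : ℕ) (hd : 2 ≤ d) (hd5 : d < 5) : ¬ d ∣ M p q := fun hdM =>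
    absurd (h.five_le_minFac.trans (Nat.minFac_le_of_dvd hd hdM)) hd5.not_ge
  exact Nat.Coprime.mul_left (m := 2) (n := 3)
    ((Nat.Prime.coprime_iff_not_dvd Nat.prime_two).2 (hdvd 2 le_rfl (by norm_num)))
    ((Nat.Prime.coprime_iff_not_dvd Nat.prime_three).2 (hdvd 3 (by norm_num) (by norm_num)))

theorem one_lt (h : IsPathEnd M p q r) : 1 < M p q := by
  have := h.five_le_minFac
  by_contra! hle
  interval_cases M p q <;> simp at this

theorem left_ne_right (h : IsPathEnd M p q r) : p ≠ q := by
  rintro rfl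
  have := h.one_lt
  simp at this

theorem ne_left (h : IsPathEnd M p q r) : r ≠ p := by
  rintro rfl
  simpa using h.three_dvd_left

theorem ne_right (h : IsPathEnd M p q r) : r ≠ q := by
  rintro rfl
  simpa using h.three_dvd_right

end IsPathEnd

theorem IsGeneratedByReflections.false_of_isPathEnd (hV : IsGeneratedByReflections cs V)
    {p q r : B} (h : IsPathEnd M p q r) {O : Set (W ⧸ V)}
    (hp : ActsAsTransposition (cs.simple p) O) (hq : ActsAsTransposition (cs.simple q) O)
    (hr : ActsAsTransposition (cs.simple r) O) : False := by
  have hpq (x : W ⧸ V) (hx : x ∈ O) : cs.simple p • x = cs.simple q • x :=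
    hp.smul_eq_smul_of_coprime hq (cs.simple_mul_simple_self p) (cs.simple_mul_simple_pow p q)
      h.coprime_six hx
  obtain ⟨u, hu, v, hv, huv, hqu⟩ := hq.exists_smul_eq
  have hpu : cs.simple p • u = v := (hpq u hu).trans hqu
  by_cases hru : cs.simple r • u = v
  · refine hV.simple_smul_ne_of_swap huv (S := {p, q}) (m := 3) ?_ (by norm_num) ?_
      (Set.mem_insert p {q}) (by simp [h.ne_left, h.ne_right]) hru
    · rintro i (rfl | rfl) <;> assumption
    · intro i hi j hj
      obtain ⟨hjp, hjq⟩ : j ≠ p ∧ j ≠ q := by simpa using hj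
      obtain rfl | hjr := eq_or_ne j r
      · refine .inr (.inr (.inr ⟨hru, ?_⟩))
        obtain rfl | rfl := hi
        exacts [h.three_dvd_left, h.three_dvd_right]
      · left
        obtain rfl | rfl := hi
        exacts [h.eq_zero_left j hjp hjq hjr, h.eq_zero_right j hjp hjq hjr]
  · have hr_fix : cs.simple r • u = u ∨ cs.simple r • v = v :=
      (hr.smul_eq_or_smul_eq_or_smul_eq hu hv huv).resolve_left hru
    refine hV.simple_smul_ne_of_swap huv (S := {p}) (m := M p q) ?_ h.one_lt ?_
      (Set.mem_singleton p) h.left_ne_right.symm hqu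
    · rintro i rfl
      exact hpu
    · rintro i rfl j hji
      obtain rfl | hjq := eq_or_ne j q
      · exact .inr (.inr (.inr ⟨hqu, dvd_rfl⟩))
      obtain rfl | hjr := eq_or_ne j r
      · exact .inr (hr_fix.imp_right .inl)
      · exact .inl (h.eq_zero_left j hji hjq hjr)

end PathEnd

section Amalgam

variable {B W : Type*} [Group W] {M : CoxeterMatrix B} {cs : CoxeterSystem M W} {V : Subgroup W}

-- The hypothesis on `M` says that `W` is the amalgamated product of the parabolic subgroup of `A`
-- with that of `(A \ A')ᶜ` over that of `A ∩ A'`.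
theorem IsGeneratedByReflections.exists_eq_add_of_amalgam {G : Type*} [AddCommGroup G]
    (hV : IsGeneratedByReflections cs V) {A A' : Set B}
    (hM : ∀ i ∈ A, i ∉ A' → ∀ j ∉ A, M i j = 0) (f : W ⧸ V → G)
    (hf : ∀ i ∈ A, i ∈ A' → ∀ x, f (cs.simple i • x) = f x) :
    ∃ g k : W ⧸ V → G, (∀ x, f x = g x + k x) ∧
      (∀ w ∈ Subgroup.closure (cs.simple '' A), ∀ x, g (w • x) = g x) ∧
      ∀ w ∈ Subgroup.closure (cs.simple '' A'), ∀ x, k (w • x) = k x := by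
  obtain ⟨g, k, hfgk, hg, hk⟩ := hV.exists_eq_add A f fun i hi j hj => by
    by_cases hi' : i ∈ A'
    · exact shearHom_mul_shearHom_pow_of_congr (f := 0) (cs.simple_mul_simple_pow i j)
        (by simp [hf i hi hi']) fun _ => rfl
    · rw [hM i hi hi' j hj, pow_zero]
  have hk' (i : B) (hi' : i ∈ A') (x : W ⧸ V) : k (cs.simple i • x) = k x := by
    by_cases hi : i ∈ A
    · refine add_left_cancel (a := g x) ?_
      rw [← hfgk, ← hf i hi hi', hfgk, hg i hi]
    · exact hk i hi x
  exact ⟨g, k, hfgk,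
    fun w hw => apply_smul_of_mem_closure (Set.forall_mem_image.2 fun i hi => hg i hi) hw,
    fun w hw => apply_smul_of_mem_closure (Set.forall_mem_image.2 hk') hw⟩

theorem exists_smul_ne_of_forall_exists_conj {G : Type*} [Group G] {H : Subgroup G} (hH : H ≠ ⊤)
    {T : Set G} (hT : Subgroup.closure T = ⊤) {g : G} (hg : ∀ t ∈ T, ∃ w, w * g * w⁻¹ = t) :
    ∃ x : G ⧸ H, g • x ≠ x := by
  contrapose! hH
  rw [eq_top_iff, ← hT, Subgroup.closure_le]
  intro t ht
  obtain ⟨w, rfl⟩ := hg t ht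
  rw [SetLike.mem_coe, ← MulAction.stabilizer_quotient H, MulAction.mem_stabilizer_iff, mul_smul,
    mul_smul, hH, smul_inv_smul]

theorem IsGeneratedByReflections.eq_top_of_isPathEnd [V.FiniteIndex]
    (hV : IsGeneratedByReflections cs V) {A A' : Set B} {h : B} (hunion : A ∪ A' = Set.univ)
    (hinter : A ∩ A' = {h})
    (hM : ∀ i ∈ A, i ∉ A' → ∀ j ∉ A, M i j = 0)
    (hconj : ∀ i ∈ A, ∃ w ∈ Subgroup.closure (cs.simple '' A),
      w * cs.simple h * w⁻¹ = cs.simple i)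
    (hconj' : ∀ i ∈ A', ∃ w ∈ Subgroup.closure (cs.simple '' A'),
      w * cs.simple h * w⁻¹ = cs.simple i)
    {p q r : B} (hpqr : IsPathEnd M p q r) (hp : {p, q, r} ⊆ A)
    {p' q' r' : B} (hpqr' : IsPathEnd M p' q' r') (hp' : {p', q', r'} ⊆ A') : V = ⊤ := by
  by_contra hne
  have hmem : h ∈ A ∩ A' := hinter.ge rfl
  have hmove : ∃ x : W ⧸ V, cs.simple h • x ≠ x :=
    exists_smul_ne_of_forall_exists_conj hne cs.subgroup_closure_range_simple <| by
      rintro _ ⟨i, rfl⟩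
      obtain hi | hi := hunion.ge (Set.mem_univ i)
      exacts [(hconj i hi).imp fun _ => And.right, (hconj' i hi).imp fun _ => And.right]
  obtain ⟨O, hO, hstab | hstab⟩ := exists_actsAsTransposition (K := ℚ)
    (cs.simple_mul_simple_self h) hmove
    (Subgroup.subset_closure (Set.mem_image_of_mem _ hmem.1))
    (Subgroup.subset_closure (Set.mem_image_of_mem _ hmem.2)) fun f hf =>
      hV.exists_eq_add_of_amalgam hM f fun i hi hi' => by
        obtain rfl := hinter.le ⟨hi, hi'⟩
        exact hf
  · have hact (i : B) (hi : i ∈ A) : ActsAsTransposition (cs.simple i) O := by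
      obtain ⟨w, hw, hwi⟩ := hconj i hi
      exact hwi ▸ hO.conj (hstab hw)
    exact hV.false_of_isPathEnd hpqr (hact p (hp (by simp))) (hact q (hp (by simp)))
      (hact r (hp (by simp)))
  · have hact (i : B) (hi : i ∈ A') : ActsAsTransposition (cs.simple i) O := by
      obtain ⟨w, hw, hwi⟩ := hconj' i hi
      exact hwi ▸ hO.conj (hstab hw)
    exact hV.false_of_isPathEnd hpqr' (hact p' (hp' (by simp))) (hact q' (hp' (by simp)))
      (hact r' (hp' (by simp)))

end Amalgam

section OddConjugation

theorem pow_mul_mul_inv_pow_eq_of_odd {G : Type*} [Group G] {a b : G} (ha : a * a = 1)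
    (hb : b * b = 1) {k : ℕ} (hab : (a * b) ^ (2 * k + 1) = 1) :
    (a * b) ^ k * a * ((a * b) ^ k)⁻¹ = b := by
  have hinv : ((a * b) ^ k)⁻¹ = (b * a) ^ k := by
    rw [← inv_pow, mul_inv_rev, inv_eq_of_mul_eq_one_left ha, inv_eq_of_mul_eq_one_left hb]
  calc (a * b) ^ k * a * ((a * b) ^ k)⁻¹
      = (a * b) ^ (2 * k) * a := by rw [hinv, mul_assoc, ← mul_pow_mul, ← mul_assoc, ← pow_add,
        two_mul]
    _ = b⁻¹ := eq_inv_of_mul_eq_one_left (by rw [mul_assoc, ← pow_succ, hab])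
    _ = b := inv_eq_of_mul_eq_one_left hb

theorem exists_mem_closure_conj_eq_of_odd {B W : Type*} [Group W] {M : CoxeterMatrix B}
    (cs : CoxeterSystem M W) {i j : B} (h : Odd (M i j)) :
    ∃ w ∈ Subgroup.closure (cs.simple '' {i, j}),
      w * cs.simple i * w⁻¹ = cs.simple j := by
  obtain ⟨k, hk⟩ := h
  refine ⟨(cs.simple i * cs.simple j) ^ k, pow_mem (mul_mem ?_ ?_) k,
    pow_mul_mul_inv_pow_eq_of_odd (cs.simple_mul_simple_self i) (cs.simple_mul_simple_self j)
      (hk ▸ cs.simple_mul_simple_pow i j)⟩ <;>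
  exact Subgroup.subset_closure (Set.mem_image_of_mem _ (by simp))

end OddConjugation

section PathSeries

variable {n : ℕ} {M : CoxeterMatrix (Fin n)}

theorem odd_of_three_le_minFac {m : ℕ} (h : 3 ≤ m.minFac) : Odd m := by
  rw [← Nat.not_even_iff_odd, even_iff_two_dvd]
  exact fun h2 => absurd (h.trans (Nat.minFac_le_of_dvd le_rfl h2)) (by norm_num)

theorem odd_of_isPathSeries (hM : M.IsPathSeries) {i j : Fin n} (hij : (j : ℕ) = i + 1) :
    Odd (M i j) := by
  apply odd_of_three_le_minFac
  by_cases hi : (i : ℕ) = 0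
  · exact le_trans (by norm_num) (hM.first_edge i j hi (by lia)).2
  by_cases hj : (j : ℕ) + 1 = n
  · exact le_trans (by norm_num) (hM.last_edge i j (by lia) hj).2
  · exact (hM.inner_edge i j (by lia) hij (by lia)).2.ge

theorem eq_zero_of_isPathSeries (hM : M.IsPathSeries) {i j : Fin n} (hij : (i : ℕ) + 1 < j)
    (hl : ¬ ((i : ℕ) = 0 ∧ (j : ℕ) = 2)) (hr : ¬ ((i : ℕ) + 3 = n ∧ (j : ℕ) + 1 = n)) :
    M i j = 0 := by
  by_contra h
  exact hM.no_other_edge i j hij hl hr ⟨by rintro rfl; lia, h⟩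

theorem three_dvd_of_adj_imp {B : Type*} {M : CoxeterMatrix B} {i j : B} (hij : i ≠ j)
    (h : M.divGraph.Adj i j → M.divLabel i j = 3) : 3 ∣ M i j := by
  by_cases h0 : M i j = 0
  · exact h0 ▸ dvd_zero 3
  · exact h ⟨hij, h0⟩ ▸ Nat.minFac_dvd (M i j)

theorem isPathEnd_left (hn : 5 ≤ n) (hM : M.IsPathSeries) {p q r : Fin n} (hp : (p : ℕ) = 0)
    (hq : (q : ℕ) = 1) (hr : (r : ℕ) = 2) : IsPathEnd M p q r where
  five_le_minFac := (hM.first_edge p q hp hq).2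
  three_dvd_left := three_dvd_of_adj_imp (by lia) (hM.left_chord p r hp hr)
  three_dvd_right :=
    three_dvd_of_adj_imp (by lia) fun _ => (hM.inner_edge q r (by lia) (by lia) (by lia)).2
  eq_zero_left j _ _ _ := eq_zero_of_isPathSeries hM (by lia) (by lia) (by lia)
  eq_zero_right j _ _ _ := eq_zero_of_isPathSeries hM (by lia) (by lia) (by lia)

theorem isPathEnd_right (hn : 5 ≤ n) (hM : M.IsPathSeries) {p q r : Fin n}
    (hp : (p : ℕ) + 1 = n) (hq : (q : ℕ) + 2 = n) (hr : (r : ℕ) + 3 = n) :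
    IsPathEnd M p q r where
  five_le_minFac := M.symmetric q p ▸ (hM.last_edge q p hq hp).2
  three_dvd_left :=
    M.symmetric r p ▸ three_dvd_of_adj_imp (by lia) (hM.right_chord r p hr hp)
  three_dvd_right := M.symmetric r q ▸
    three_dvd_of_adj_imp (by lia) fun _ => (hM.inner_edge r q (by lia) (by lia) (by lia)).2
  eq_zero_left j _ _ _ :=
    M.symmetric j p ▸ eq_zero_of_isPathSeries hM (by lia) (by lia) (by lia)
  eq_zero_right j _ _ _ :=
    M.symmetric j q ▸ eq_zero_of_isPathSeries hM (by lia) (by lia) (by lia)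

variable {W : Type*} [Group W] (cs : CoxeterSystem M W)

theorem exists_mem_closure_conj_eq_of_le (hM : M.IsPathSeries) {i j : Fin n} (hij : i ≤ j) :
    ∃ w ∈ Subgroup.closure (cs.simple '' Set.Icc i j), w * cs.simple i * w⁻¹ = cs.simple j := by
  obtain ⟨j, hj⟩ := j
  induction j, (show (i : ℕ) ≤ j from hij) using Nat.le_induction with
  | base => exact ⟨1, one_mem _, by simp⟩
  | succ j hij' ih =>
    have hjj : (⟨j, by lia⟩ : Fin n) ≤ ⟨j + 1, hj⟩ := j.le_succ
    obtain ⟨w, hw, hwi⟩ := ih (by lia) hij'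
    obtain ⟨w', hw', hwj⟩ := exists_mem_closure_conj_eq_of_odd cs
      (odd_of_isPathSeries hM (i := ⟨j, by lia⟩) (j := ⟨j + 1, hj⟩) rfl)
    refine ⟨w' * w, mul_mem ?_ ?_, by rw [← hwj, ← hwi]; group⟩
    · refine Subgroup.closure_mono (Set.image_mono ?_) hw'
      rintro _ (rfl | rfl)
      exacts [⟨hij', hjj⟩, ⟨hij, le_rfl⟩]
    · exact Subgroup.closure_mono (Set.image_mono (Set.Icc_subset_Icc_right hjj)) hw

theorem exists_mem_closure_conj_eq_of_ordConnected (hM : M.IsPathSeries) {A : Set (Fin n)}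
    [hA : A.OrdConnected] {i j : Fin n} (hi : i ∈ A) (hj : j ∈ A) :
    ∃ w ∈ Subgroup.closure (cs.simple '' A), w * cs.simple i * w⁻¹ = cs.simple j := by
  obtain hij | hji := le_total i j
  · obtain ⟨w, hw, hwij⟩ := exists_mem_closure_conj_eq_of_le cs hM hij
    exact ⟨w, Subgroup.closure_mono (Set.image_mono (hA.out hi hj)) hw, hwij⟩
  · obtain ⟨w, hw, hwji⟩ := exists_mem_closure_conj_eq_of_le cs hM hji
    exact ⟨w⁻¹, inv_mem (Subgroup.closure_mono (Set.image_mono (hA.out hj hi)) hw),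
      by rw [← hwji]; group⟩

end PathSeries

theorem lemma5p18 {n : ℕ} (hn : 5 ≤ n) (M : CoxeterMatrix (Fin n)) (hM : M.IsPathSeries)
    {W : Type*} [Group W] (cs : CoxeterSystem M W) :
    ¬ ∃ V : Subgroup W, cs.IsReflectionSubgroup V ∧ V.FiniteIndex := by
  rintro ⟨V, ⟨hne, hV⟩, hfin⟩
  let h : Fin n := ⟨2, by lia⟩
  have hsplit (i : Fin n) (hi : i ∉ Set.Ici h) (j : Fin n) (hj : j ∉ Set.Iic h) : M i j = 0 := by
    simp only [Set.mem_Ici, Set.mem_Iic, not_le, Fin.lt_def, h] at hi hj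
    exact eq_zero_of_isPathSeries hM (by lia) (by lia) (by lia)
  exact hne <| IsGeneratedByReflections.eq_top_of_isPathEnd (cs := cs) hV
    (A := Set.Iic h) (A' := Set.Ici h) (h := h) Set.Iic_union_Ici
    (Set.Iic_inter_Ici.trans (Set.Icc_self h))
    (fun i _ => hsplit i)
    (fun _ => exists_mem_closure_conj_eq_of_ordConnected cs hM Set.self_mem_Iic)
    (fun _ => exists_mem_closure_conj_eq_of_ordConnected cs hM Set.self_mem_Ici)
    (isPathEnd_left hn hM (p := ⟨0, by lia⟩) (q := ⟨1, by lia⟩) (r := h) rfl rfl rfl)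
    (by simp [Set.insert_subset_iff, Fin.le_def, h])
    (isPathEnd_right hn hM (p := ⟨n - 1, by lia⟩) (q := ⟨n - 2, by lia⟩) (r := ⟨n - 3, by lia⟩)
      (by simp; lia) (by simp; lia) (by simp; lia))
    (by simp [Set.insert_subset_iff, Fin.le_def, h]; lia)
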